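/- Let $n\ge 2$, let $w_1,\dots,w_n$ be positive integers and put $d=\sum_{i=1}^n w_i$. Assume that $w_i\mid d$ for all $i$ and that $w_1\mid w_n$. For $a\in\mathbb C$ let $\mathcal X_a$ be the fibre over $a$ of the one-parameter family of Calabi–Yau hypersurfaces in the complex weighted projective space $\mathbb P_{w_1,\dots,w_n}$ given by $$F_a=\Big(\sum_{i=1}^n x_i^{d/w_i}\Big)+a\,x_1^{(d-w_n)/w_1}x_n=0 .$$ A singular point of $\mathcal X_a$ is a point $[x]$ of $\mathbb P_{w_1,\dots,w_n}$ such that $F_a$ and all $\partial F_a/\partial x_i$ vanish at $x$ (that is, the affine cone over $\mathcal X_a$ is singular at $x\ne0$; singularities that $\mathcal X_a$ only inherits from the quotient structure of $\mathbb P_{w_1,\dots,w_n}$ are not counted). The local equation of such a point with $x_1\neq 0$ is taken in the affine chart $x_1=1$ with coordinates $x_2,\dots,x_n$ (before dividing by the group of $w_1$-th roots of unity). The discriminant is the set of all $a\in\mathbb C$ for which $\mathcal X_a$ has a singular point. Then the discriminant of the family is $$V\left(a^{\frac d{w_n}}+(-1)^{\frac d{w_n}-1}\frac{d^{\frac d{w_n}}}{w_n(d-w_n)^{\frac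 d{w_n}-1}}\right)\subset\mathbb A^1_{\mathbb C},$$ and it consists of exactly $d/w_n$ points. For each $a$ in the discriminant, $\mathcal X_a$ has precisely one singular point. It lies in the chart $x_1\neq0$ and its local equation $F_a(1,x_2,\dots,x_n)=0$ has there an isolated singularity, whose normal form under a local biholomorphic change of coordinates (moving the point to the origin) is $$\Big(\sum_{i=2}^{n-1}x_i^{d/w_i}\Big)+x_n^2 ,$$ and whose Milnor number is finite and equal to $\mu=\prod_{i=2}^{n-1}\left(\frac d{w_i}-1\right)$. -/

import Mathlib

open scoped Topology

noncomputable section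

namespace WeightedFermat

/-- Two nonzero vectors of `ℂⁿ` are identified when they lie in the same orbit of the action
`t • (x₁, …, xₙ) = (t ^ w₁ x₁, …, t ^ wₙ xₙ)` of `ℂˣ`. -/
def weightedSetoid {n : ℕ} (w : Fin n → ℕ) : Setoid {v : Fin n → ℂ // v ≠ 0} where
  r u v := ∃ t : ℂˣ, ∀ i, v.1 i = (t : ℂ) ^ w i * u.1 i
  iseqv :=
    { refl := fun u => ⟨1, fun i => by simp⟩
      symm := by
        rintro u v ⟨t, ht⟩
        refine ⟨t⁻¹, fun i => ?_⟩
        rw [ht i, ← mul_assoc, ← mul_pow]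
        simp
      trans := by
        rintro u v z ⟨t, ht⟩ ⟨s, hs⟩
        refine ⟨s * t, fun i => ?_⟩
        rw [hs i, ht i, Units.val_mul, mul_pow, mul_assoc] }

/-- The (complex points of the) weighted projective space `ℙ_{w₁, …, wₙ}`. -/
def WeightedProjectiveSpace {n : ℕ} (w : Fin n → ℕ) : Type :=
  Quotient (weightedSetoid w)

/-- The point `[x₁ : … : xₙ]` of weighted projective space. -/
def WeightedProjectiveSpace.mk {n : ℕ} (w : Fin n → ℕ) (v : Fin n → ℂ) (hv : v ≠ 0) :
    WeightedProjectiveSpace w :=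
  Quotient.mk (weightedSetoid w) ⟨v, hv⟩

/-- `v` is a singular point of the affine hypersurface `f = 0`: the polynomial and all its partial
derivatives vanish at `v`. -/
def IsSingularAt {n : ℕ} (f : MvPolynomial (Fin n) ℂ) (v : Fin n → ℂ) : Prop :=
  MvPolynomial.eval v f = 0 ∧ ∀ i, MvPolynomial.eval v (MvPolynomial.pderiv i f) = 0

/-- The singular points of the hypersurface `F = 0` in weighted projective space (`F` weighted
homogeneous): the points over which the affine cone `F = 0` is singular. The singularities which
the ambient space itself has as a quotient are not counted. -/
def singularLocus {n : ℕ} (w : Fin n → ℕ) (F : MvPolynomial (Fin n) ℂ) :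
    Set (WeightedProjectiveSpace w) :=
  {p | ∃ (v : Fin n → ℂ) (hv : v ≠ 0), WeightedProjectiveSpace.mk w v hv = p ∧ IsSingularAt F v}

/-- The discriminant of a one-parameter family of hypersurfaces in weighted projective space: the
set of the parameter values whose fibre has a singular point. -/
def discriminant {n : ℕ} (w : Fin n → ℕ) (F : ℂ → MvPolynomial (Fin n) ℂ) : Set ℂ :=
  {a | (singularLocus w (F a)).Nonempty}

lemma cons_one_ne_zero {k : ℕ} (q : Fin k → ℂ) : (Fin.cons 1 q : Fin (k + 1) → ℂ) ≠ 0 := by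
  intro h
  simpa using congrFun h 0

/-- The affine chart `(x₂, …, xₙ) ↦ [1 : x₂ : … : xₙ]` of weighted projective space, whose image
is `x₁ ≠ 0` (it is the quotient map by the group of `w₁`-th roots of unity). -/
def chart {k : ℕ} (w : Fin (k + 1) → ℕ) (q : Fin k → ℂ) : WeightedProjectiveSpace w :=
  WeightedProjectiveSpace.mk w (Fin.cons 1 q) (cons_one_ne_zero q)

/-- The equation `F(1, x₂, …, xₙ)` of a hypersurface in the affine chart `x₁ = 1`. -/
def chartEquation {k : ℕ} (F : MvPolynomial (Fin (k + 1)) ℂ) : MvPolynomial (Fin k) ℂ :=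
  MvPolynomial.aeval
    (Fin.cons 1 MvPolynomial.X : Fin (k + 1) → MvPolynomial (Fin k) ℂ) F

/-- `p` is an isolated singular point of the affine hypersurface `f = 0`. -/
def IsIsolatedSingularity {k : ℕ} (f : MvPolynomial (Fin k) ℂ) (p : Fin k → ℂ) : Prop :=
  IsSingularAt f p ∧ ∀ᶠ y in 𝓝[≠] p, ¬ IsSingularAt f y

/-- The germ of `f` at `p` is taken to the germ of `g` at `q` by a local biholomorphic change of
coordinates `φ : (ℂᵏ, q) → (ℂᵏ, p)`, i.e. `f ∘ φ = g` near `q`. -/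
def HasLocalForm {k : ℕ} (f : MvPolynomial (Fin k) ℂ) (p : Fin k → ℂ)
    (g : MvPolynomial (Fin k) ℂ) (q : Fin k → ℂ) : Prop :=
  ∃ φ : OpenPartialHomeomorph (Fin k → ℂ) (Fin k → ℂ),
    q ∈ φ.source ∧ φ q = p ∧
    AnalyticOnNhd ℂ φ φ.source ∧ AnalyticOnNhd ℂ φ.symm φ.target ∧
    ∀ y ∈ φ.source, MvPolynomial.eval (φ y) f = MvPolynomial.eval y g

/-- The maximal ideal of the polynomials which vanish at `p`. -/
def idealAt {k : ℕ} (p : Fin k → ℂ) : Ideal (MvPolynomial (Fin k) ℂ) :=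
  RingHom.ker (MvPolynomial.eval p)

instance idealAt_isPrime {k : ℕ} (p : Fin k → ℂ) : (idealAt p).IsPrime :=
  RingHom.ker_isPrime (MvPolynomial.eval p)

/-- The local ring of affine space `𝔸ᵏ` at `p`: the localization of the polynomial ring at the
maximal ideal of the polynomials which vanish at `p`. -/
abbrev LocalRingAt {k : ℕ} (p : Fin k → ℂ) : Type :=
  Localization.AtPrime (idealAt p)

/-- The Milnor algebra of `f` at `p`: the local ring at `p` modulo the partial derivatives. -/
abbrev MilnorAlgebra {k : ℕ} (f : MvPolynomial (Fin k) ℂ) (p : Fin k → ℂ) : Type :=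
  LocalRingAt p ⧸ Ideal.span
    (Set.range fun i : Fin k => algebraMap (MvPolynomial (Fin k) ℂ) (LocalRingAt p)
      (MvPolynomial.pderiv i f))

/-- The Milnor number of `f` at `p` (meaningful when the Milnor algebra is finite-dimensional). -/
def milnorNumber {k : ℕ} (f : MvPolynomial (Fin k) ℂ) (p : Fin k → ℂ) : ℕ :=
  Module.finrank ℂ (MilnorAlgebra f p)

/-- With `n = m + 2` variables `x₁, …, xₙ` (indexed by `0, …, m + 1`), the polynomial
`F = ∑ xᵢ ^ (d / wᵢ) + a x₁ ^ ((d - wₙ) / w₁) xₙ`. -/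
def familyF {m : ℕ} (d : ℕ) (w : Fin (m + 2) → ℕ) (a : ℂ) : MvPolynomial (Fin (m + 2)) ℂ :=
  (∑ i, MvPolynomial.X i ^ (d / w i)) +
    MvPolynomial.C a * MvPolynomial.X 0 ^ ((d - w (Fin.last (m + 1))) / w 0) *
      MvPolynomial.X (Fin.last (m + 1))

/-- The polynomial `x₂ ^ (d / w₂) + ⋯ + x_{n-1} ^ (d / w_{n-1}) + xₙ ^ 2` in the `n - 1 = m + 1`
variables `x₂, …, xₙ` (indexed by `0, …, m`; the variable `i` has weight `w i.succ`). -/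
def normalForm {m : ℕ} (d : ℕ) (w : Fin (m + 2) → ℕ) : MvPolynomial (Fin (m + 1)) ℂ :=
  (∑ i : Fin m, MvPolynomial.X i.castSucc ^ (d / w i.castSucc.succ)) +
    MvPolynomial.X (Fin.last m) ^ 2

end WeightedFermat

end

noncomputable section

namespace WeightedFermat

open MvPolynomial

/-! Write `e = d / wₙ` and `c = wₙ / w₁`. Every weight is less than `d`, so all exponents `d / wᵢ`
are at least 2. The derivatives in the middle variables force those variables to vanish at a
singular point. The derivative in `xₙ` is `e xₙ ^ (e - 1) + a x₁ ^ (c (e - 1))`, so `x₁ = 0` would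
give `xₙ = 0`; hence `x₁ ≠ 0`, and the `ℂˣ`-action moves the point to `x₁ = 1`
(`mem_singularLocus_familyF_iff`). What remains is a multiple root `t` of `h = 1 + t ^ e + a t`; the
derivative in `x₁` adds nothing, by Euler's relation.

A multiple root satisfies `(e - 1) t ^ e = 1` and `t = -e / ((e - 1) a)`. It is thus unique for
given `a`, and it exists exactly when `a ^ e = (-e) ^ e / (e - 1) ^ (e - 1)`, an equation with `e`
solutions (`exists_trinomial_multiple_root_iff`, `ncard_setOf_pow_eq`).

The chart equation is a sum of functions of separate variables: the powers `xⱼ ^ (d / wⱼ)` and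
`h(xₙ)`. Since `h''(t) ≠ 0`, a one-variable coordinate change turns `h` into a square, which gives
the normal form. Up to local units the partial derivatives are powers of the `xᵢ - qᵢ`, so the
Milnor algebra has a basis of monomials in a box (`milnorAlgebra_of_pderiv`). -/

/-! ### Singular points of the chart equation and of the affine cone -/

lemma chartEquation_familyF {m d : ℕ} (w : Fin (m + 2) → ℕ) (a : ℂ) :
    chartEquation (familyF d w a) =
      1 + (∑ j : Fin m, X j.castSucc ^ (d / w j.castSucc.succ)) +
        X (Fin.last m) ^ (d / w (Fin.last (m + 1))) + C a * X (Fin.last m) := by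
  have hl : (Fin.last (m + 1)) = (Fin.last m).succ := rfl
  simp only [chartEquation, familyF, Fin.sum_univ_succ (n := m + 1), Fin.sum_univ_castSucc (n := m),
    map_add, map_sum, map_mul, map_pow, aeval_X, hl, Fin.cons_zero, Fin.cons_succ, one_pow,
    mul_one, aeval_C, algebraMap_eq]
  ring

lemma pderiv_castSucc_chartEquation {m d : ℕ} (w : Fin (m + 2) → ℕ) (a : ℂ) (j : Fin m) :
    pderiv j.castSucc (chartEquation (familyF d w a)) =
      C ((d / w j.castSucc.succ : ℕ) : ℂ) * X j.castSucc ^ (d / w j.castSucc.succ - 1) := by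
  rw [chartEquation_familyF]
  simp [pderiv_X, Derivation.leibniz_pow, Pi.single_apply,
    (Fin.castSucc_lt_last j).ne', Derivation.leibniz]

lemma pderiv_last_chartEquation {m d : ℕ} (w : Fin (m + 2) → ℕ) (a : ℂ) :
    pderiv (Fin.last m) (chartEquation (familyF d w a)) =
      C ((d / w (Fin.last (m + 1)) : ℕ) : ℂ) * X (Fin.last m) ^ (d / w (Fin.last (m + 1)) - 1) +
        C a := by
  rw [chartEquation_familyF]
  simp [pderiv_X, Derivation.leibniz_pow, (Fin.castSucc_lt_last _).ne,
    Derivation.leibniz]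

lemma isSingularAt_chartEquation_iff {m d : ℕ} {w : Fin (m + 2) → ℕ} (hw : ∀ i, 2 ≤ d / w i)
    (a : ℂ) (y : Fin (m + 1) → ℂ) :
    IsSingularAt (chartEquation (familyF d w a)) y ↔
      (∀ j : Fin m, y j.castSucc = 0) ∧
        1 + y (Fin.last m) ^ (d / w (Fin.last (m + 1))) + a * y (Fin.last m) = 0 ∧
        ((d / w (Fin.last (m + 1)) : ℕ) : ℂ) *
          y (Fin.last m) ^ (d / w (Fin.last (m + 1)) - 1) + a = 0 := by
  have h1 : ∀ j : Fin m, d / w j.castSucc.succ ≠ 0 := fun j => by have := hw j.castSucc.succ; lia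
  have h2 : ∀ j : Fin m, d / w j.castSucc.succ - 1 ≠ 0 :=
    fun j => by have := hw j.castSucc.succ; lia
  have key : (∀ i, eval y (pderiv i (chartEquation (familyF d w a))) = 0) ↔
      (∀ j : Fin m, y j.castSucc = 0) ∧ ((d / w (Fin.last (m + 1)) : ℕ) : ℂ) *
          y (Fin.last m) ^ (d / w (Fin.last (m + 1)) - 1) + a = 0 := by
    rw [Fin.forall_fin_succ']
    refine and_congr (forall_congr' fun j => ?_) ?_
    · rw [pderiv_castSucc_chartEquation, map_mul, map_pow, eval_C, eval_X, mul_eq_zero,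
        pow_eq_zero_iff (h2 j), Nat.cast_eq_zero]
      simp only [h1 j, false_or]
    · rw [pderiv_last_chartEquation, map_add, map_mul, map_pow, eval_C, eval_X, eval_C]
  rw [IsSingularAt, key, chartEquation_familyF]
  simp only [map_add, map_sum, map_mul, map_pow, eval_X, eval_C, map_one]
  constructor
  · rintro ⟨h, h0, h'⟩
    refine ⟨h0, ?_, h'⟩
    simpa [h0, h1] using h
  · rintro ⟨h0, h, h'⟩
    refine ⟨?_, h0, h'⟩
    simpa [h0, h1] using h

lemma isSingularAt_familyF_iff {m d : ℕ} {w : Fin (m + 2) → ℕ} (hw : ∀ i, 2 ≤ d / w i)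
    (a : ℂ) (v : Fin (m + 2) → ℂ) :
    IsSingularAt (familyF d w a) v ↔
      (∀ j : Fin m, v j.castSucc.succ = 0) ∧
        v 0 ^ (d / w 0) + v (Fin.last (m + 1)) ^ (d / w (Fin.last (m + 1))) +
          a * v 0 ^ ((d - w (Fin.last (m + 1))) / w 0) * v (Fin.last (m + 1)) = 0 ∧
        ((d / w 0 : ℕ) : ℂ) * v 0 ^ (d / w 0 - 1) +
          a * (((d - w (Fin.last (m + 1))) / w 0 : ℕ) : ℂ) *
            v 0 ^ ((d - w (Fin.last (m + 1))) / w 0 - 1) * v (Fin.last (m + 1)) = 0 ∧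
        ((d / w (Fin.last (m + 1)) : ℕ) : ℂ) *
          v (Fin.last (m + 1)) ^ (d / w (Fin.last (m + 1)) - 1) +
            a * v 0 ^ ((d - w (Fin.last (m + 1))) / w 0) = 0 := by
  have h1 : ∀ j : Fin m, d / w j.castSucc.succ ≠ 0 := fun j => by have := hw j.castSucc.succ; lia
  have h2 : ∀ j : Fin m, d / w j.castSucc.succ - 1 ≠ 0 :=
    fun j => by have := hw j.castSucc.succ; lia
  have hn : ∀ j : Fin m, j.castSucc.succ ≠ Fin.last (m + 1) := fun j => by
    rw [← Fin.succ_last]; exact fun h => (Fin.castSucc_lt_last j).ne (Fin.succ_injective _ h)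
  have hl : (0 : Fin (m + 2)) ≠ Fin.last (m + 1) := Fin.last_pos.ne
  have hF : familyF d w a = X 0 ^ (d / w 0) +
      (∑ j : Fin m, X j.castSucc.succ ^ (d / w j.castSucc.succ)) +
        X (Fin.last (m + 1)) ^ (d / w (Fin.last (m + 1))) +
        C a * X 0 ^ ((d - w (Fin.last (m + 1))) / w 0) * X (Fin.last (m + 1)) := by
    rw [familyF, Fin.sum_univ_succ, Fin.sum_univ_castSucc, Fin.succ_last]
    ring
  have key : (∀ i, eval v (pderiv i (familyF d w a)) = 0) ↔
      ((d / w 0 : ℕ) : ℂ) * v 0 ^ (d / w 0 - 1) +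
          a * (((d - w (Fin.last (m + 1))) / w 0 : ℕ) : ℂ) *
            v 0 ^ ((d - w (Fin.last (m + 1))) / w 0 - 1) * v (Fin.last (m + 1)) = 0 ∧
      (∀ j : Fin m, v j.castSucc.succ = 0) ∧
      ((d / w (Fin.last (m + 1)) : ℕ) : ℂ) *
          v (Fin.last (m + 1)) ^ (d / w (Fin.last (m + 1)) - 1) +
            a * v 0 ^ ((d - w (Fin.last (m + 1))) / w 0) = 0 := by
    rw [Fin.forall_fin_succ, Fin.forall_fin_succ', hF]
    refine and_congr ?_ (and_congr (forall_congr' fun j => ?_) ?_)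
    · refine Eq.congr_left ?_
      simp [pderiv_X, Derivation.leibniz_pow, hl.symm, Derivation.leibniz,
        Fin.succ_ne_zero]
      ring
    · have : eval v (pderiv j.castSucc.succ (X 0 ^ (d / w 0) +
          (∑ j : Fin m, X j.castSucc.succ ^ (d / w j.castSucc.succ)) +
          X (Fin.last (m + 1)) ^ (d / w (Fin.last (m + 1))) +
          C a * X 0 ^ ((d - w (Fin.last (m + 1))) / w 0) * X (Fin.last (m + 1)))) =
          ((d / w j.castSucc.succ : ℕ) : ℂ) * v j.castSucc.succ ^ (d / w j.castSucc.succ - 1) := by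
        simp [pderiv_X, Derivation.leibniz_pow, Pi.single_apply, (hn _).symm,
          Derivation.leibniz, (Fin.succ_ne_zero _).symm]
      rw [this, mul_eq_zero, pow_eq_zero_iff (h2 j), Nat.cast_eq_zero]
      simp only [h1 j, false_or]
    · rw [Fin.succ_last]
      refine Eq.congr_left ?_
      simp [pderiv_X, Derivation.leibniz_pow, hl, Derivation.leibniz,
        hn]
  rw [IsSingularAt, key, hF]
  simp only [map_add, map_sum, map_mul, map_pow, eval_X, eval_C]
  constructor
  · rintro ⟨h, h', h0, h''⟩
    refine ⟨h0, ?_, h', h''⟩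
    simpa [h0, h1] using h
  · rintro ⟨h0, h, h', h''⟩
    refine ⟨?_, h', h0, h''⟩
    simpa [h0, h1] using h

/-! ### The local normal form -/

/-- A polynomial with a root of multiplicity two has a holomorphic local square root, which is a
local coordinate. -/
lemma exists_openPartialHomeomorph_eval_eq_sq (h : Polynomial ℂ) (t : ℂ) (h0 : h.eval t = 0)
    (h1 : h.derivative.eval t = 0) (h2 : h.derivative.derivative.eval t ≠ 0) :
    ∃ ψ : OpenPartialHomeomorph ℂ ℂ, 0 ∈ ψ.source ∧ ψ 0 = t ∧
      DifferentiableOn ℂ ψ ψ.source ∧ DifferentiableOn ℂ ψ.symm ψ.target ∧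
      ∀ z ∈ ψ.source, h.eval (ψ z) = z ^ 2 := by
  obtain ⟨g, rfl⟩ := Polynomial.dvd_iff_isRoot.mpr h0
  have hg : g.eval t = 0 := by simpa using h1
  obtain ⟨u, rfl⟩ := Polynomial.dvd_iff_isRoot.mpr hg
  have hu : u.eval t ≠ 0 := by
    intro hu
    apply h2
    simp [hu]
  obtain ⟨s, hs⟩ := IsAlgClosed.exists_pow_nat_eq (u.eval t) two_pos
  have hs0 : s ≠ 0 := by rintro rfl; apply hu; simp [← hs]
  -- Dividing by `u.eval t` makes the ratio 1 at `t`, inside the slit plane, so its principal square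
  -- root is holomorphic on `V`; the factor `s` compensates for the division.
  set V : Set ℂ := {z | u.eval z / u.eval t ∈ Complex.slitPlane} with hV
  have hVo : IsOpen V := Complex.isOpen_slitPlane.preimage (by fun_prop)
  have htV : t ∈ V := by simp [hV, hu]
  set r : ℂ → ℂ := fun z => (z - t) * (s * (u.eval z / u.eval t) ^ (1 / 2 : ℂ)) with hr
  have hk : DifferentiableOn ℂ (fun z => s * (u.eval z / u.eval t) ^ (1 / 2 : ℂ)) V := by
    refine DifferentiableOn.const_mul ?_ _
    refine DifferentiableOn.cpow ?_ (differentiableOn_const _) (fun z hz => hz)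
    exact (u.differentiable.div_const _).differentiableOn
  have hrd : DifferentiableOn ℂ r V := ((differentiable_id.sub_const t).differentiableOn).mul hk
  have hra : AnalyticOnNhd ℂ r V := hrd.analyticOnNhd hVo
  have hr2 : ∀ z, r z ^ 2 =
      ((Polynomial.X - Polynomial.C t) * ((Polynomial.X - Polynomial.C t) * u)).eval z := by
    intro z
    have : ((u.eval z / u.eval t) ^ (1 / 2 : ℂ)) ^ 2 = u.eval z / u.eval t := by
      rw [← Complex.cpow_nat_mul]; simp
    simp only [hr, mul_pow, this, hs, Polynomial.eval_mul, Polynomial.eval_sub, Polynomial.eval_X,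
      Polynomial.eval_C]
    field_simp
  have hdr : HasDerivAt r s t := by
    have := ((hasDerivAt_id t).sub_const t).mul (hk.differentiableAt (hVo.mem_nhds htV)).hasDerivAt
    simpa [hr, hu, Pi.mul_def] using this
  have hrt : r t = 0 := by simp [hr]
  have hstrict : HasStrictDerivAt r s t := by
    have := (hra t htV).hasStrictDerivAt
    rwa [hdr.deriv] at this
  -- On `W` the derivative of `r` does not vanish, so the local inverse is holomorphic on its whole
  -- domain and not only at `0`.
  set W : Set ℂ := V ∩ (deriv r) ⁻¹' {0}ᶜ with hW
  have hWo : IsOpen W := hra.deriv.continuousOn.isOpen_inter_preimage hVo isOpen_compl_singleton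
  have htW : t ∈ W := ⟨htV, by simpa [hdr.deriv] using hs0⟩
  have hF := hstrict.hasStrictFDerivAt_equiv hs0
  set E := (hF.toOpenPartialHomeomorph r).restrOpen W hWo with hE
  have hEr : ∀ z, E z = r z := fun z => rfl
  have htE : t ∈ E.source := by
    rw [hE, OpenPartialHomeomorph.restrOpen_source]
    exact ⟨hF.mem_toOpenPartialHomeomorph_source, htW⟩
  have hsub : E.source ⊆ W := by
    rw [hE, OpenPartialHomeomorph.restrOpen_source]
    exact Set.inter_subset_right
  have h0E : (0 : ℂ) ∈ E.target := by
    rw [← hrt, ← hEr]; exact E.map_source htE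
  refine ⟨E.symm, h0E, ?_, ?_, ?_, ?_⟩
  · rw [← hrt, ← hEr]; exact E.left_inv htE
  · intro z hz
    have hz' := hsub (E.map_target hz)
    refine (E.hasDerivAt_symm hz hz'.2 ?_).differentiableAt.differentiableWithinAt
    exact (hrd.differentiableAt (hVo.mem_nhds hz'.1)).hasDerivAt
  · rw [OpenPartialHomeomorph.symm_symm, OpenPartialHomeomorph.symm_target]
    exact hrd.mono (hsub.trans Set.inter_subset_left)
  · intro z hz
    rw [← hr2, ← hEr, E.right_inv hz]

/-- A product of one-variable biholomorphisms is a biholomorphism; this suffices because the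
variables are separated. -/
lemma hasLocalForm_of_openPartialHomeomorph {k : ℕ} {f g : MvPolynomial (Fin k) ℂ}
    (ψ : Fin k → OpenPartialHomeomorph ℂ ℂ) (q : Fin k → ℂ) (hq : ∀ i, q i ∈ (ψ i).source)
    (hd : ∀ i, DifferentiableOn ℂ (ψ i) (ψ i).source)
    (hd' : ∀ i, DifferentiableOn ℂ (ψ i).symm (ψ i).target)
    (h : ∀ y : Fin k → ℂ, (∀ i, y i ∈ (ψ i).source) →
      eval (fun i => ψ i (y i)) f = eval y g) :
    HasLocalForm f (fun i => ψ i (q i)) g q := by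
  refine ⟨OpenPartialHomeomorph.pi ψ, fun i _ => hq i, rfl, ?_, ?_, fun y hy => h y fun i => hy i trivial⟩
  · intro y hy
    refine AnalyticAt.pi fun i => ?_
    exact ((hd i).analyticAt ((ψ i).open_source.mem_nhds (hy i trivial))).comp_of_eq
      (ContinuousLinearMap.analyticAt (ContinuousLinearMap.proj (R := ℂ) i) y) rfl
  · intro y hy
    refine AnalyticAt.pi fun i => ?_
    exact ((hd' i).analyticAt ((ψ i).open_target.mem_nhds (hy i trivial))).comp_of_eq
      (ContinuousLinearMap.analyticAt (ContinuousLinearMap.proj (R := ℂ) i) y) rfl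

lemma hasLocalForm_chartEquation {m d : ℕ} {w : Fin (m + 2) → ℕ}
    (hw : 2 ≤ d / w (Fin.last (m + 1))) {a : ℂ} {q : Fin (m + 1) → ℂ}
    (hq : ∀ j : Fin m, q j.castSucc = 0)
    (h0 : 1 + q (Fin.last m) ^ (d / w (Fin.last (m + 1))) + a * q (Fin.last m) = 0)
    (h1 : ((d / w (Fin.last (m + 1)) : ℕ) : ℂ) *
          q (Fin.last m) ^ (d / w (Fin.last (m + 1)) - 1) + a = 0)
    (hne : q (Fin.last m) ≠ 0) :
    HasLocalForm (chartEquation (familyF d w a)) q (normalForm d w) 0 := by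
  generalize he : d / w (Fin.last (m + 1)) = e at *
  obtain ⟨ψ, hψ0, hψt, hψd, hψd', hψ⟩ := exists_openPartialHomeomorph_eval_eq_sq
    (1 + Polynomial.X ^ e + Polynomial.C a * Polynomial.X) (q (Fin.last m)) (by simpa using h0)
    (by simpa [Polynomial.derivative_X_pow] using h1) (by
      have : (e : ℂ) - 1 ≠ 0 := by
        rw [sub_ne_zero]; exact_mod_cast (by lia : e ≠ 1)
      have : ((e - 1 : ℕ) : ℂ) ≠ 0 := by exact_mod_cast (by lia : e - 1 ≠ 0)
      have : (e : ℂ) ≠ 0 := by exact_mod_cast (by lia : e ≠ 0)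
      simp [Polynomial.derivative_X_pow, *])
  -- The coordinate change is `ψ` in the last variable and the identity in the others, where `q`
  -- vanishes.
  have hqeq : q = fun i => Fin.lastCases (motive := fun _ => OpenPartialHomeomorph ℂ ℂ) ψ
      (fun _ => OpenPartialHomeomorph.refl ℂ) i ((0 : Fin (m + 1) → ℂ) i) := by
    funext i
    induction i using Fin.lastCases with
    | last => simp [hψt]
    | cast j => simp [hq]
  rw [hqeq]
  apply hasLocalForm_of_openPartialHomeomorph
  · intro i
    induction i using Fin.lastCases with
    | last => simpa using hψ0
    | cast j => simp
  · intro i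
    induction i using Fin.lastCases with
    | last => simpa using hψd
    | cast j => simpa using differentiableOn_id
  · intro i
    induction i using Fin.lastCases with
    | last => simpa using hψd'
    | cast j => simpa using differentiableOn_id
  · intro y hy
    have hy' := hψ (y (Fin.last m)) (by simpa using hy (Fin.last m))
    rw [chartEquation_familyF, normalForm, he]
    simp only [map_add, map_sum, map_mul, map_pow, eval_X, eval_C, map_one, Fin.lastCases_last,
      Fin.lastCases_castSucc, OpenPartialHomeomorph.refl_apply, id]
    simp only [Polynomial.eval_add, Polynomial.eval_mul, Polynomial.eval_one, Polynomial.eval_pow,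
      Polynomial.eval_X, Polynomial.eval_C] at hy'
    rw [← hy']
    ring

/-! ### The Milnor number -/

/-- If all elements outside the prime `M` are units modulo `I`, then localizing at `M` does not
change the quotient by `I`. -/
lemma exists_linearEquiv_quotient_map_localization {K R : Type*} [Field K] [CommRing R]
    [Algebra K R] (M I : Ideal R) [M.IsPrime] (hI : ∀ s, s ∉ M → ∃ t, 1 - s * t ∈ I) :
    Nonempty ((R ⧸ I) ≃ₗ[K]
      (Localization.AtPrime M ⧸ I.map (algebraMap R (Localization.AtPrime M)))) := by
  let f : R →ₐ[K] (Localization.AtPrime M ⧸ I.map (algebraMap R (Localization.AtPrime M))) :=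
    (Ideal.Quotient.mkₐ K _).comp (IsScalarTower.toAlgHom K R (Localization.AtPrime M))
  have hf : Function.Surjective f := by
    intro y
    obtain ⟨x, rfl⟩ := Ideal.Quotient.mk_surjective y
    obtain ⟨r, s, rfl⟩ := IsLocalization.exists_mk'_eq M.primeCompl x
    obtain ⟨t, ht⟩ := hI s s.2
    refine ⟨r * t, ?_⟩
    change Ideal.Quotient.mk _ (algebraMap R (Localization.AtPrime M) (r * t)) = _
    rw [eq_comm, Ideal.Quotient.eq]
    have : IsLocalization.mk' (Localization.AtPrime M) r s - algebraMap R _ (r * t) =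
        IsLocalization.mk' (Localization.AtPrime M) r s * algebraMap R _ (1 - s * t) := by
      have := IsLocalization.mk'_spec (Localization.AtPrime M) r s
      simp only [map_sub, map_mul, map_one]
      linear_combination (algebraMap R (Localization.AtPrime M) t) * this
    rw [this]
    exact Ideal.mul_mem_left _ _ (Ideal.mem_map_of_mem _ ht)
  have hker : RingHom.ker f = I := by
    ext r
    have : r ∈ RingHom.ker f ↔ algebraMap R (Localization.AtPrime M) r ∈
        I.map (algebraMap R (Localization.AtPrime M)) := Ideal.Quotient.eq_zero_iff_mem
    rw [this]
    refine ⟨fun h => ?_, fun h => Ideal.mem_map_of_mem _ h⟩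
    obtain ⟨s, hs, hsr⟩ :=
      (IsLocalization.algebraMap_mem_map_algebraMap_iff M.primeCompl _ I r).mp h
    obtain ⟨t, ht⟩ := hI s hs
    -- Both summands lie in `I`: `t` inverts `s` modulo `I`, and `s` multiplies `r` into `I`.
    have : r = r * (1 - s * t) + t * (s * r) := by ring
    rw [this]
    exact I.add_mem (I.mul_mem_left _ ht) (I.mul_mem_left _ hsr)
  exact ⟨((Ideal.quotientEquivAlgOfEq K hker.symm).trans
    (Ideal.quotientKerAlgEquivOfSurjective hf)).toLinearEquiv⟩

/-- The ideal generated by the powers `(xᵢ - qᵢ) ^ bᵢ`. -/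
def powerIdeal {k : ℕ} (q : Fin k → ℂ) (b : Fin k → ℕ) : Ideal (MvPolynomial (Fin k) ℂ) :=
  Ideal.span (Set.range fun i => (X i - C (q i)) ^ b i)

/-- Modulo the ideal each `xᵢ - qᵢ` is nilpotent, so every polynomial differs from its value at `q`
by a nilpotent. If that value is nonzero, the class is a unit plus a nilpotent, hence a unit. -/
lemma exists_one_sub_mul_mem_powerIdeal {k : ℕ} (q : Fin k → ℂ) (b : Fin k → ℕ)
    (s : MvPolynomial (Fin k) ℂ) (hs : s ∉ idealAt q) : ∃ t, 1 - s * t ∈ powerIdeal q b := by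
  set I := powerIdeal q b
  have hX : ∀ i, IsNilpotent (Ideal.Quotient.mk I (X i - C (q i))) := fun i =>
    ⟨b i, by
      rw [← map_pow, Ideal.Quotient.eq_zero_iff_mem]
      exact Ideal.subset_span ⟨i, rfl⟩⟩
  have hnil : ∀ p : MvPolynomial (Fin k) ℂ,
      Ideal.Quotient.mk I (p - C (eval q p)) ∈ nilradical (MvPolynomial (Fin k) ℂ ⧸ I) := by
    intro p
    induction p using MvPolynomial.induction_on with
    | C a => simp
    | add p p' hp hp' =>
      have : p + p' - C (eval q (p + p')) = (p - C (eval q p)) + (p' - C (eval q p')) := by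
        simp only [map_add]; ring
      rw [this, map_add]
      exact Ideal.add_mem _ hp hp'
    | mul_X p i hp =>
      have : p * X i - C (eval q (p * X i)) =
          X i * (p - C (eval q p)) + C (eval q p) * (X i - C (q i)) := by
        simp only [map_mul, eval_X]; ring
      rw [this, map_add, map_mul, map_mul]
      exact Ideal.add_mem _ (Ideal.mul_mem_left _ _ hp) (Ideal.mul_mem_left _ _ (hX i))
  have hsq : eval q s ≠ 0 := hs
  have hu : IsUnit (Ideal.Quotient.mk I (C (eval q s))) :=
    ((isUnit_iff_ne_zero.mpr hsq).map C).map _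
  have hu' : IsUnit (Ideal.Quotient.mk I s) := by
    have := (mem_nilradical.mp (hnil s)).isUnit_add_left_of_commute hu (Commute.all _ _)
    rwa [← map_add, add_sub_cancel] at this
  obtain ⟨y, hy⟩ := hu'.exists_right_inv
  obtain ⟨t, rfl⟩ := Ideal.Quotient.mk_surjective y
  refine ⟨t, ?_⟩
  rw [← Ideal.Quotient.eq_zero_iff_mem, map_sub, map_mul, hy, map_one, sub_self]

/-- Translation of the coordinates by `q`. -/
def translate {k : ℕ} (q : Fin k → ℂ) : MvPolynomial (Fin k) ℂ ≃ₐ[ℂ] MvPolynomial (Fin k) ℂ :=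
  AlgEquiv.ofAlgHom (aeval fun i => X i + C (q i)) (aeval fun i => X i - C (q i))
    (by ext i; simp [← algebraMap_eq]) (by ext i; simp [← algebraMap_eq])

lemma map_translate_powerIdeal {k : ℕ} (q : Fin k → ℂ) (b : Fin k → ℕ) :
    (powerIdeal q b).map (translate q) = powerIdeal 0 b := by
  rw [powerIdeal, Ideal.map_span, ← Set.range_comp, powerIdeal]
  congr 2
  funext i
  simp [translate]

/-- The coefficients at the exponents below `b`. -/
def boxCoeff {k : ℕ} (b : Fin k → ℕ) :
    MvPolynomial (Fin k) ℂ →ₗ[ℂ] ((∀ i, Fin (b i)) → ℂ) :=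
  LinearMap.pi fun c => lcoeff ℂ (Finsupp.equivFunOnFinite.symm fun i => (c i : ℕ))

lemma boxCoeff_surjective {k : ℕ} (b : Fin k → ℕ) : Function.Surjective (boxCoeff b) := by
  intro g
  refine ⟨∑ c, monomial (Finsupp.equivFunOnFinite.symm fun i => (c i : ℕ)) (g c), ?_⟩
  funext c
  change coeff _ _ = _
  rw [coeff_sum, Finset.sum_eq_single c]
  · simp
  · intro c' _ hc
    rw [coeff_monomial, if_neg]
    intro h
    apply hc
    funext i
    exact Fin.ext (congrFun (Finsupp.equivFunOnFinite.symm.injective h) i)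
  · simp

/-- The ideal is monomial, so membership is tested on the support: each exponent must reach `b i` in
some coordinate, that is, lie outside the box. -/
lemma ker_boxCoeff {k : ℕ} (b : Fin k → ℕ) :
    LinearMap.ker (boxCoeff b) = (powerIdeal 0 b).restrictScalars ℂ := by
  have hI : powerIdeal 0 b = Ideal.span ((fun s => monomial s (1 : ℂ)) ''
      Set.range fun i => Finsupp.single i (b i)) := by
    rw [powerIdeal, ← Set.range_comp]
    congr 2
    funext i
    simp [X_pow_eq_monomial]
  ext p
  rw [Submodule.restrictScalars_mem, hI, mem_ideal_span_monomial_image, LinearMap.mem_ker]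
  constructor
  · intro h x hx
    by_contra! hcon
    have hlt : ∀ i, x i < b i := by
      intro i
      by_contra! hi
      exact hcon _ ⟨i, rfl⟩ (by simpa using hi)
    have := congrFun h fun i => ⟨x i, hlt i⟩
    rw [mem_support_iff] at hx
    apply hx
    have hxx : x = Finsupp.equivFunOnFinite.symm fun i => x i := by ext; rfl
    rw [hxx]
    exact this
  · intro h
    funext c
    change coeff _ p = 0
    by_contra hc
    obtain ⟨_, ⟨i, rfl⟩, hi⟩ := h _ (mem_support_iff.mpr hc)
    have := hi i
    simp only [Finsupp.single_eq_same, Finsupp.equivFunOnFinite_symm_apply_apply] at this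
    exact absurd (c i).2 (not_lt.mpr this)

lemma exists_linearEquiv_quotient_powerIdeal {k : ℕ} (q : Fin k → ℂ) (b : Fin k → ℕ) :
    Nonempty ((MvPolynomial (Fin k) ℂ ⧸ powerIdeal q b) ≃ₗ[ℂ] ((∀ i, Fin (b i)) → ℂ)) := by
  have e1 := (Ideal.quotientEquivAlg (powerIdeal q b) (powerIdeal 0 b) (translate q)
    (map_translate_powerIdeal q b).symm).toLinearEquiv
  have e2 := (boxCoeff b).quotKerEquivOfSurjective (boxCoeff_surjective b)
  have e3 := Submodule.quotEquivOfEq _ _ (ker_boxCoeff b)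
  have e4 := Submodule.Quotient.restrictScalarsEquiv ℂ (powerIdeal (0 : Fin k → ℂ) b)
  exact ⟨e1 ≪≫ₗ e4.symm ≪≫ₗ e3.symm ≪≫ₗ e2⟩

/-- If the partial derivatives of `f` are `(xᵢ - pᵢ) ^ bᵢ` up to units of the local ring at `p`,
then the Milnor number of `f` at `p` is `∏ bᵢ`. -/
lemma milnorAlgebra_of_pderiv {k : ℕ} (f : MvPolynomial (Fin k) ℂ) (p : Fin k → ℂ)
    (b : Fin k → ℕ) (u : Fin k → MvPolynomial (Fin k) ℂ) (hu : ∀ i, eval p (u i) ≠ 0)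
    (hf : ∀ i, pderiv i f = u i * (X i - C (p i)) ^ b i) :
    Module.Finite ℂ (MilnorAlgebra f p) ∧ milnorNumber f p = ∏ i, b i := by
  have hI : Ideal.span (Set.range fun i : Fin k =>
      algebraMap (MvPolynomial (Fin k) ℂ) (LocalRingAt p) (pderiv i f)) =
      (powerIdeal p b).map (algebraMap (MvPolynomial (Fin k) ℂ) (LocalRingAt p)) := by
    rw [powerIdeal, Ideal.map_span, ← Set.range_comp]
    have hunit : ∀ i, IsUnit (algebraMap (MvPolynomial (Fin k) ℂ) (LocalRingAt p) (u i)) :=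
      fun i => IsLocalization.map_units _ (⟨u i, hu i⟩ : (idealAt p).primeCompl)
    apply le_antisymm
    · rw [Ideal.span_le]
      rintro _ ⟨i, rfl⟩
      simp only [hf, map_mul]
      exact Ideal.mul_mem_left _ _ (Ideal.subset_span ⟨i, rfl⟩)
    · rw [Ideal.span_le]
      rintro _ ⟨i, rfl⟩
      refine ((Ideal.span _).unit_mul_mem_iff_mem (hunit i)).mp (Ideal.subset_span ⟨i, ?_⟩)
      simp [hf]
  obtain ⟨e⟩ := exists_linearEquiv_quotient_map_localization (K := ℂ) (idealAt p) (powerIdeal p b)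
    (exists_one_sub_mul_mem_powerIdeal p b)
  obtain ⟨e'⟩ := exists_linearEquiv_quotient_powerIdeal p b
  have e'' : MilnorAlgebra f p ≃ₗ[ℂ] ((∀ i, Fin (b i)) → ℂ) :=
    (Ideal.quotientEquivAlgOfEq ℂ hI).toLinearEquiv ≪≫ₗ e.symm ≪≫ₗ e'
  refine ⟨Module.Finite.equiv e''.symm, ?_⟩
  rw [milnorNumber, e''.finrank_eq, Module.finrank_fintype_fun_eq_card, Fintype.card_pi]
  simp

lemma milnorAlgebra_chartEquation {m d : ℕ} {w : Fin (m + 2) → ℕ} (hw : ∀ i, 2 ≤ d / w i)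
    {a : ℂ} {q : Fin (m + 1) → ℂ} (hq : ∀ j : Fin m, q j.castSucc = 0)
    (h1 : ((d / w (Fin.last (m + 1)) : ℕ) : ℂ) *
          q (Fin.last m) ^ (d / w (Fin.last (m + 1)) - 1) + a = 0)
    (hne : q (Fin.last m) ≠ 0) :
    Module.Finite ℂ (MilnorAlgebra (chartEquation (familyF d w a)) q) ∧
      milnorNumber (chartEquation (familyF d w a)) q =
        ∏ i : Fin m, (d / w i.castSucc.succ - 1) := by
  have hpos : ∀ i, ((d / w i : ℕ) : ℂ) ≠ 0 := fun i => by
    have := hw i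
    exact_mod_cast (by lia : d / w i ≠ 0)
  -- In the last variable the derivative is `e (X ^ (e - 1) - t ^ (e - 1))`, where `t` is the last
  -- coordinate of `q`. The geometric sum is its cofactor to `X - t`, with value `(e - 1) t ^ (e -
  -- 2) ≠ 0` at `q`.
  have := milnorAlgebra_of_pderiv (chartEquation (familyF d w a)) q
    (Fin.lastCases 1 fun i => d / w i.castSucc.succ - 1)
    (Fin.lastCases (C ((d / w (Fin.last (m + 1)) : ℕ) : ℂ) *
      ∑ i ∈ Finset.range (d / w (Fin.last (m + 1)) - 1),
        X (Fin.last m) ^ i * C (q (Fin.last m)) ^ (d / w (Fin.last (m + 1)) - 1 - 1 - i))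
      fun i => C ((d / w i.castSucc.succ : ℕ) : ℂ)) ?_ ?_
  · simpa [Fin.prod_univ_castSucc] using this
  · intro i
    induction i using Fin.lastCases with
    | last =>
      have h2 : ((d / w (Fin.last (m + 1)) - 1 : ℕ) : ℂ) ≠ 0 := by
        have := hw (Fin.last (m + 1))
        exact_mod_cast (by lia : d / w (Fin.last (m + 1)) - 1 ≠ 0)
      rw [Fin.lastCases_last, map_mul, eval_C, map_sum]
      refine mul_ne_zero (hpos _) ?_
      simp only [map_mul, map_pow, eval_X, eval_C]
      rw [Finset.sum_congr rfl fun i hi => by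
        rw [← pow_add, show i + (d / w (Fin.last (m + 1)) - 1 - 1 - i) =
          d / w (Fin.last (m + 1)) - 1 - 1 by have := Finset.mem_range.mp hi; lia]]
      rw [Finset.sum_const, Finset.card_range, nsmul_eq_mul]
      exact mul_ne_zero h2 (pow_ne_zero _ hne)
    | cast j => simpa using hpos j.castSucc.succ
  · intro i
    induction i using Fin.lastCases with
    | last =>
      rw [Fin.lastCases_last, Fin.lastCases_last, pderiv_last_chartEquation, pow_one, mul_assoc,
        geom_sum₂_mul, eq_neg_of_add_eq_zero_right h1]
      simp only [map_neg, map_mul, map_pow]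
      ring
    | cast j => rw [Fin.lastCases_castSucc, Fin.lastCases_castSucc,
        pderiv_castSucc_chartEquation, hq, C_0, sub_zero]

/-! ### Multiple roots of the trinomial -/

/-- A trinomial `1 + t ^ e + a t` with a multiple root `t` has `a = -e / ((e - 1) t)`. -/
lemma eq_of_trinomial_multiple_root {e : ℕ} (he : 2 ≤ e) {a t : ℂ} (h0 : 1 + t ^ e + a * t = 0)
    (h1 : (e : ℂ) * t ^ (e - 1) + a = 0) :
    t ≠ 0 ∧ a ≠ 0 ∧ ((e : ℂ) - 1) * t ^ e = 1 ∧ t = -(e : ℂ) / (((e : ℂ) - 1) * a) := by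
  have ht : t ≠ 0 := by
    rintro rfl
    simp [show e ≠ 0 by lia] at h0
  have hs : t ^ e = t ^ (e - 1) * t := by rw [← pow_succ]; congr 1; lia
  have he0 : (e : ℂ) ≠ 0 := by exact_mod_cast (by lia : e ≠ 0)
  have he1 : (e : ℂ) - 1 ≠ 0 := by
    rw [sub_ne_zero]; exact_mod_cast (by lia : e ≠ 1)
  have ha : a ≠ 0 := by
    rintro rfl
    simp [he0, ht] at h1
  -- The combination `t h'(t) - h(t)` eliminates `a`.
  have hte : ((e : ℂ) - 1) * t ^ e = 1 := by linear_combination t * h1 - h0 + e * hs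
  refine ⟨ht, ha, hte, ?_⟩
  rw [eq_div_iff (mul_ne_zero he1 ha)]
  linear_combination ((e : ℂ) - 1) * t * h1 - e * hte + (e : ℂ) * (e - 1) * hs

lemma exists_trinomial_multiple_root_iff {e : ℕ} (he : 2 ≤ e) (a : ℂ) :
    (∃ t : ℂ, 1 + t ^ e + a * t = 0 ∧ (e : ℂ) * t ^ (e - 1) + a = 0) ↔
      a ^ e = (-(e : ℂ)) ^ e / ((e : ℂ) - 1) ^ (e - 1) := by
  have he0 : (e : ℂ) ≠ 0 := by exact_mod_cast (by lia : e ≠ 0)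
  have he1 : (e : ℂ) - 1 ≠ 0 := by
    rw [sub_ne_zero]; exact_mod_cast (by lia : e ≠ 1)
  have hs : ∀ x : ℂ, x ^ e = x ^ (e - 1) * x := fun x => by rw [← pow_succ]; congr 1; lia
  constructor
  · rintro ⟨t, h0, h1⟩
    obtain ⟨ht, ha, hte, hta⟩ := eq_of_trinomial_multiple_root he h0 h1
    have hat : a * (((e : ℂ) - 1) * t) = -e := by
      rw [eq_div_iff (mul_ne_zero he1 ha)] at hta
      linear_combination hta
    rw [eq_div_iff (pow_ne_zero _ he1), ← hat, mul_pow, mul_pow, hs ((e : ℂ) - 1)]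
    linear_combination (-(a ^ e * ((e : ℂ) - 1) ^ (e - 1))) * hte
  · intro h
    have ha : a ≠ 0 := by
      rintro rfl
      rw [zero_pow (by lia), eq_comm] at h
      exact div_ne_zero (pow_ne_zero _ (neg_ne_zero.mpr he0)) (pow_ne_zero _ he1) h
    -- The only candidate, by `eq_of_trinomial_multiple_root`.
    set t : ℂ := -(e : ℂ) / (((e : ℂ) - 1) * a) with ht
    have hat : a * ((e : ℂ) - 1) * t = -e := by rw [ht]; field_simp
    have hte : ((e : ℂ) - 1) * t ^ e = 1 := by
      have h2 : (a * ((e : ℂ) - 1) * t) ^ e = (-(e : ℂ)) ^ e := by rw [hat]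
      rw [mul_pow, mul_pow, h, hs ((e : ℂ) - 1)] at h2
      have h3 : (-(e : ℂ)) ^ e ≠ 0 := pow_ne_zero _ (neg_ne_zero.mpr he0)
      have h4 : ((e : ℂ) - 1) ^ (e - 1) ≠ 0 := pow_ne_zero _ he1
      apply mul_left_cancel₀ h3
      rw [mul_one]
      refine Eq.trans ?_ h2
      field_simp
    have ht0 : t ≠ 0 := by
      rw [ht]
      exact div_ne_zero (neg_ne_zero.mpr he0) (mul_ne_zero he1 ha)
    refine ⟨t, ?_, ?_⟩
    · apply mul_left_cancel₀ he1
      linear_combination hte + hat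
    · apply mul_left_cancel₀ (mul_ne_zero he1 ht0)
      linear_combination (e : ℂ) * hte + hat - (e : ℂ) * ((e : ℂ) - 1) * hs t

lemma ncard_setOf_pow_eq {e : ℕ} (he : 0 < e) {c : ℂ} (hc : c ≠ 0) :
    {a : ℂ | a ^ e = c}.ncard = e := by
  classical
  obtain ⟨α, hα⟩ := IsAlgClosed.exists_pow_nat_eq c he
  have hζ := Complex.isPrimitiveRoot_exp e he.ne'
  have : {a : ℂ | a ^ e = c} = ((Polynomial.nthRoots e c).toFinset : Set ℂ) := by
    ext a
    simp [Polynomial.mem_nthRoots he]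
  rw [this, Set.ncard_coe_finset, Multiset.toFinset_card_of_nodup (hζ.nthRoots_nodup hc),
    hζ.card_nthRoots, if_pos ⟨α, hα⟩]

/-! ### Singular points in weighted projective space -/

/-- There are at least two positive weights, so each is a proper divisor of their sum. -/
lemma two_le_div {m d : ℕ} {w : Fin (m + 2) → ℕ} (hpos : ∀ i, 0 < w i) (hd : d = ∑ i, w i)
    (hdvd : ∀ i, w i ∣ d) (i : Fin (m + 2)) : 2 ≤ d / w i := by
  obtain ⟨j, hj⟩ := exists_ne i
  have hlt : w i < d := by
    rw [hd]
    exact Finset.single_lt_sum hj (Finset.mem_univ _) (Finset.mem_univ _) (hpos j)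
      fun _ _ _ => Nat.zero_le _
  obtain ⟨k, hk⟩ := hdvd i
  rw [hk, Nat.mul_div_cancel_left _ (hpos i)]
  by_contra! h
  have : w i * k ≤ w i * 1 := Nat.mul_le_mul_left _ (by lia)
  lia

/-- The only singular points of the fibre over `a` are `[1 : 0 : … : 0 : t]` with `t` a multiple
root of `1 + t ^ e + a t`. -/
lemma mem_singularLocus_familyF_iff {m d : ℕ} {w : Fin (m + 2) → ℕ} (hpos : ∀ i, 0 < w i)
    (hd : d = ∑ i, w i) (hdvd : ∀ i, w i ∣ d) (hw : w 0 ∣ w (Fin.last (m + 1))) (a : ℂ)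
    (p : WeightedProjectiveSpace w) :
    p ∈ singularLocus w (familyF d w a) ↔
      ∃ q : Fin (m + 1) → ℂ, chart w q = p ∧ IsSingularAt (chartEquation (familyF d w a)) q := by
  have h2 := two_le_div hpos hd hdvd
  obtain ⟨c, hc⟩ := hw
  have hc0 : 0 < c := by
    have := hpos (Fin.last (m + 1))
    rw [hc] at this
    exact Nat.pos_of_mul_pos_left this
  have h2l := h2 (Fin.last (m + 1))
  obtain ⟨e, he⟩ := hdvd (Fin.last (m + 1))
  have hde : d / w (Fin.last (m + 1)) = e := by
    rw [he, Nat.mul_div_cancel_left _ (hpos _)]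
  rw [hde] at h2l
  have hd0 : d / w 0 = c * e := by
    rw [he, hc, mul_assoc, Nat.mul_div_cancel_left _ (hpos _)]
  have hK : (d - w (Fin.last (m + 1))) / w 0 = c * (e - 1) := by
    have : d - w (Fin.last (m + 1)) = w 0 * (c * (e - 1)) := by
      rw [he, ← Nat.mul_sub_one, hc, mul_assoc]
    rw [this, Nat.mul_div_cancel_left _ (hpos _)]
  have hs : ∀ x : ℂ, x ^ e = x ^ (e - 1) * x := fun x => by rw [← pow_succ]; congr 1; lia
  have he1 : e - 1 ≠ 0 := by lia
  have hce : c * e = c * (e - 1) + c := by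
    rw [← Nat.mul_succ]; congr 1; lia
  constructor
  · rintro ⟨v, hv, rfl, hsing⟩
    rw [isSingularAt_familyF_iff h2, hde, hd0, hK] at hsing
    obtain ⟨hmid, hF, -, hl⟩ := hsing
    have hv0 : v 0 ≠ 0 := by
      intro h0
      apply hv
      have hlast : v (Fin.last (m + 1)) = 0 := by
        rw [h0, zero_pow (Nat.mul_ne_zero hc0.ne' he1)] at hl
        have : (e : ℂ) ≠ 0 := by exact_mod_cast (by lia : e ≠ 0)
        simpa [this, he1] using hl
      funext i
      induction i using Fin.cases with
      | zero => exact h0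
      | succ i =>
        induction i using Fin.lastCases with
        | last => rw [Fin.succ_last]; exact hlast
        | cast j => exact hmid j
    -- Acting by this `w₁`-th root of `v 0` carries a chart point to `v`. It multiplies the last
    -- coordinate by `s ^ wₙ = v 0 ^ c`, which explains the choice of `t` below.
    obtain ⟨s, hsw⟩ := IsAlgClosed.exists_pow_nat_eq (v 0) (hpos 0)
    have hs0 : s ≠ 0 := by
      rintro rfl
      exact hv0 (by rw [← hsw, zero_pow (hpos 0).ne'])
    obtain ⟨t, ht⟩ : ∃ t, v (Fin.last (m + 1)) = t * v 0 ^ c :=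
      ⟨v (Fin.last (m + 1)) / v 0 ^ c, by field_simp⟩
    refine ⟨Fin.lastCases t fun _ => 0, ?_, ?_⟩
    · refine Quotient.sound (⟨Units.mk0 s hs0, fun i => ?_⟩ : (weightedSetoid w).r _ _)
      change v i = s ^ w i * Fin.cons (α := fun _ => ℂ) 1 _ i
      induction i using Fin.cases with
      | zero => simp [hsw]
      | succ i =>
        induction i using Fin.lastCases with
        | last =>
          rw [Fin.cons_succ, Fin.lastCases_last, Fin.succ_last, ht, hc, pow_mul, hsw, mul_comm]
        | cast j => simp [hmid j]
    · rw [isSingularAt_chartEquation_iff h2, hde]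
      simp only [Fin.lastCases_last, Fin.lastCases_castSucc, implies_true, true_and]
      rw [ht] at hF hl
      constructor
      · apply mul_left_cancel₀ (pow_ne_zero (c * e) hv0)
        rw [mul_pow, ← pow_mul] at hF
        rw [mul_zero, ← hF, hce]
        ring
      · apply mul_left_cancel₀ (pow_ne_zero (c * (e - 1)) hv0)
        rw [mul_pow, ← pow_mul] at hl
        rw [mul_zero, ← hl]
        ring
  · rintro ⟨q, rfl, hq⟩
    refine ⟨_, cons_one_ne_zero q, rfl, ?_⟩
    rw [isSingularAt_chartEquation_iff h2, hde] at hq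
    obtain ⟨hmid, h0, h1⟩ := hq
    rw [isSingularAt_familyF_iff h2, hde, hd0, hK, ← Fin.succ_last]
    simp only [Fin.cons_succ, Fin.cons_zero, one_pow, mul_one]
    refine ⟨hmid, h0, ?_, h1⟩
    push_cast [show 1 ≤ e by lia]
    -- Euler's relation on the chart: the derivative in `x₁` is `c e h(t) - c t h'(t)`.
    linear_combination (c : ℂ) * e * h0 - c * q (Fin.last m) * h1 - c * e * hs (q (Fin.last m))

lemma isSingularAt_chartEquation_unique {m d : ℕ} {w : Fin (m + 2) → ℕ}
    (hw : ∀ i, 2 ≤ d / w i) {a : ℂ} {q q' : Fin (m + 1) → ℂ}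
    (hq : IsSingularAt (chartEquation (familyF d w a)) q)
    (hq' : IsSingularAt (chartEquation (familyF d w a)) q') : q = q' := by
  rw [isSingularAt_chartEquation_iff hw] at hq hq'
  funext i
  induction i using Fin.lastCases with
  | last =>
    rw [(eq_of_trinomial_multiple_root (hw _) hq.2.1 hq.2.2).2.2.2,
      (eq_of_trinomial_multiple_root (hw _) hq'.2.1 hq'.2.2).2.2.2]
  | cast j => rw [hq.1, hq'.1]

end WeightedFermat

end

/-! ### The main theorem -/

open WeightedFermat in
theorem mainTheorem7 (m d : ℕ) (w : Fin (m + 2) → ℕ)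
    (hpos : ∀ i, 0 < w i) (hd : d = ∑ i, w i) (hdvd : ∀ i, w i ∣ d)
    (hw : w 0 ∣ w (Fin.last (m + 1))) :
    discriminant w (familyF d w) =
        {a : ℂ | a ^ (d / w (Fin.last (m + 1))) +
          (-1) ^ (d / w (Fin.last (m + 1)) - 1) *
            ((d : ℂ) ^ (d / w (Fin.last (m + 1))) /
              ((w (Fin.last (m + 1)) : ℂ) *
                ((d : ℂ) - (w (Fin.last (m + 1)) : ℂ)) ^ (d / w (Fin.last (m + 1)) - 1))) = 0} ∧
      (discriminant w (familyF d w)).ncard = d / w (Fin.last (m + 1)) ∧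
      ∀ a ∈ discriminant w (familyF d w),
        ∃ q : Fin (m + 1) → ℂ,
          singularLocus w (familyF d w a) = {chart w q} ∧
          IsIsolatedSingularity (chartEquation (familyF d w a)) q ∧
          HasLocalForm (chartEquation (familyF d w a)) q (normalForm d w) 0 ∧
          Module.Finite ℂ (MilnorAlgebra (chartEquation (familyF d w a)) q) ∧
          milnorNumber (chartEquation (familyF d w a)) q =
            ∏ i : Fin m, (d / w i.castSucc.succ - 1) := by
  have h2 := two_le_div hpos hd hdvd
  have hmem := mem_singularLocus_familyF_iff hpos hd hdvd hw
  have hdisc : discriminant w (familyF d w) = {a : ℂ | a ^ (d / w (Fin.last (m + 1))) =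
      (-((d / w (Fin.last (m + 1)) : ℕ) : ℂ)) ^ (d / w (Fin.last (m + 1))) /
        (((d / w (Fin.last (m + 1)) : ℕ) : ℂ) - 1) ^ (d / w (Fin.last (m + 1)) - 1)} := by
    ext a
    rw [Set.mem_ofPred_eq, ← exists_trinomial_multiple_root_iff (h2 _)]
    constructor
    · rintro ⟨p, hp⟩
      obtain ⟨q, -, hq⟩ := (hmem a p).mp hp
      exact ⟨_, ((isSingularAt_chartEquation_iff h2 a q).mp hq).2⟩
    · rintro ⟨t, ht⟩
      refine ⟨chart w (Fin.lastCases t fun _ => 0), (hmem a _).mpr ⟨_, rfl, ?_⟩⟩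
      rw [isSingularAt_chartEquation_iff h2]
      simpa using ht
  have he0 : ((d / w (Fin.last (m + 1)) : ℕ) : ℂ) ≠ 0 := by
    have := h2 (Fin.last (m + 1))
    exact_mod_cast (by lia : d / w (Fin.last (m + 1)) ≠ 0)
  have he1 : ((d / w (Fin.last (m + 1)) : ℕ) : ℂ) - 1 ≠ 0 := by
    have := h2 (Fin.last (m + 1))
    rw [sub_ne_zero]
    exact_mod_cast (by lia : d / w (Fin.last (m + 1)) ≠ 1)
  refine ⟨?_, ?_, ?_⟩
  · rw [hdisc]
    ext a
    rw [Set.mem_ofPred_eq, Set.mem_ofPred_eq, ← sub_eq_zero]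
    refine Eq.congr_left ?_
    -- Substituting `d = wₙ e` and `d - wₙ = wₙ (e - 1)` cancels all powers of `wₙ`; the sign comes
    -- from `-(-1) ^ e = (-1) ^ (e - 1)`.
    have hdw : (d : ℂ) = w (Fin.last (m + 1)) * ((d / w (Fin.last (m + 1)) : ℕ) : ℂ) := by
      exact_mod_cast (Nat.mul_div_cancel' (hdvd (Fin.last (m + 1)))).symm
    have hw0 : (w (Fin.last (m + 1)) : ℂ) ≠ 0 := by exact_mod_cast (hpos _).ne'
    rw [hdw]
    obtain ⟨k, hk⟩ : ∃ k, d / w (Fin.last (m + 1)) = k + 1 :=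
      ⟨d / w (Fin.last (m + 1)) - 1, by have := h2 (Fin.last (m + 1)); lia⟩
    rw [hk] at he0 he1 ⊢
    rw [Nat.add_sub_cancel, ← mul_sub_one, mul_pow _ _ k, neg_pow, pow_succ (-1 : ℂ) k,
      mul_pow _ _ (k + 1), pow_succ (w (Fin.last (m + 1)) : ℂ) k]
    field_simp
    ring
  · rw [hdisc]
    refine ncard_setOf_pow_eq (by have := h2 (Fin.last (m + 1)); lia) ?_
    exact div_ne_zero (pow_ne_zero _ (neg_ne_zero.mpr he0)) (pow_ne_zero _ he1)
  · rintro a ⟨p, hp⟩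
    obtain ⟨q, -, hq⟩ := (hmem a p).mp hp
    obtain ⟨hmid, h0, h1⟩ := (isSingularAt_chartEquation_iff h2 a q).mp hq
    have hne := (eq_of_trinomial_multiple_root (h2 _) h0 h1).1
    refine ⟨q, ?_, ⟨hq, ?_⟩, hasLocalForm_chartEquation (h2 _) hmid h0 h1 hne,
      milnorAlgebra_chartEquation h2 hmid h1 hne⟩
    · ext p'
      rw [hmem, Set.mem_singleton_iff]
      constructor
      · rintro ⟨q', rfl, hq'⟩
        rw [isSingularAt_chartEquation_unique h2 hq hq']
      · rintro rfl
        exact ⟨q, rfl, hq⟩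
    -- The singular point is isolated because the chart equation has no other one at all.
    · filter_upwards [self_mem_nhdsWithin] with y hy hy'
      exact hy (isSingularAt_chartEquation_unique h2 hy' hq)
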